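/- Let $(\Omega,\Sigma,\mu)$ be a complete probability space, and suppose that there is an infinite sequence $(A_i)_{i\in\mathbb N}$ of pairwise disjoint elements of $\Sigma$ with $\mu(A_i)>0$ for all $i$. Let $1<p<\infty$ and $\frac1p+\frac1{p'}=1$. Let $Z$ be a (real) Köthe function space over $\mu$, i.e. an order ideal of $L^1(\mu)$ containing all simple functions and equipped with a complete lattice norm. Suppose that $Z$ is order continuous (the norm tends to $0$ along every downward directed set with infimum $0$) and $p'$-convex, i.e. there is $C>0$ such that $$\Big\|\Big(\sum_{i=1}^n|z_i|^{p'}\Big)^{1/p'}\Big\|_Z\le C\Big(\sum_{i=1}^n\|z_i\|_Z^{p'}\Big)^{1/p'}\quad\text{for all } n\in\mathbb N,\ z_1,\dots,z_n\in Z.$$ Then there is a strongly measurable function $\phi:\Omega\to Z$ (an a.e. norm limit of a sequence of simple functions) with the following properties. It is $p$-Pettis integrable: $\langle\phi,z^*\rangle\in L^p(\mu)$ for every $z^*\in Z^*$, and for every $A\in\Sigma$ there is $z_A\in Z$ with $\langle z_A,z^*\rangle=\int_A\langle\phi,z^*\rangle\,d\mu$ for all $z^*\in Z^*$. Its Dunford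 operator $T^p_\phi:L^{p'}(\mu)\to Z^{**}$, the adjoint of the operator $Z^*\to L^p(\mu)$, $z^*\mapsto\langle\phi,z^*\rangle$, takes values in (the canonical copy of) $Z$, and the operator $T^p_\phi:L^{p'}(\mu)\to Z$ is not compact. -/

import Mathlib

open MeasureTheory Filter Topology
open scoped ENNReal

noncomputable section

section Integrability

/-- `f : Ω → X` is `p`-Dunford integrable: `⟨f, x*⟩ ∈ L^p(μ)` for every `x* ∈ X*`. -/
def IsPDunfordIntegrable {Ω : Type*} [MeasurableSpace Ω] {X : Type*} [NormedAddCommGroup X]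
    [NormedSpace ℝ X] (p : ℝ≥0∞) (f : Ω → X) (μ : Measure Ω) : Prop :=
  ∀ x' : StrongDual ℝ X, MemLp (fun ω => x' (f ω)) p μ

/-- `f : Ω → X` is Pettis integrable: it is (`1`-)Dunford integrable and for each measurable `A`
the functional `x* ↦ ∫_A ⟨f, x*⟩ dμ` is the evaluation at an element of `X`. -/
def IsPettisIntegrable {Ω : Type*} [MeasurableSpace Ω] {X : Type*} [NormedAddCommGroup X]
    [NormedSpace ℝ X] (f : Ω → X) (μ : Measure Ω) : Prop :=
  IsPDunfordIntegrable 1 f μ ∧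
    ∀ A : Set Ω, MeasurableSet A → ∃ x : X, ∀ x' : StrongDual ℝ X, x' x = ∫ ω in A, x' (f ω) ∂μ

/-- `p`-Pettis integrable means `p`-Dunford integrable and Pettis integrable. -/
def IsPPettisIntegrable {Ω : Type*} [MeasurableSpace Ω] {X : Type*} [NormedAddCommGroup X]
    [NormedSpace ℝ X] (p : ℝ≥0∞) (f : Ω → X) (μ : Measure Ω) : Prop :=
  IsPDunfordIntegrable p f μ ∧ IsPettisIntegrable f μ

/-- The linear map `x* ↦ ⟨f, x*⟩` from `X*` to `L^p(μ)`. -/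
def dunfordPreadjointLinear {Ω : Type*} [MeasurableSpace Ω] {μ : Measure Ω} {X : Type*}
    [NormedAddCommGroup X] [NormedSpace ℝ X] {p : ℝ≥0∞} {f : Ω → X}
    (hf : IsPDunfordIntegrable p f μ) : StrongDual ℝ X →ₗ[ℝ] Lp ℝ p μ where
  toFun x' := (hf x').toLp _
  map_add' _ _ := rfl
  map_smul' _ _ := rfl

theorem dunfordPreadjointLinear_continuous {Ω : Type*} [MeasurableSpace Ω] {μ : Measure Ω}
    {X : Type*} [NormedAddCommGroup X] [NormedSpace ℝ X] {p : ℝ≥0∞} [Fact (1 ≤ p)] {f : Ω → X}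
    (hf : IsPDunfordIntegrable p f μ) : Continuous (dunfordPreadjointLinear hf) := by
  refine LinearMap.continuous_of_seq_closed_graph _ fun u x y hu hy => ?_
  obtain ⟨ns, hns, hae⟩ := (tendstoInMeasure_of_tendsto_Lp hy).exists_seq_tendsto_ae
  refine Lp.ext ?_
  have hall : ∀ᵐ ω ∂μ, ∀ n, (dunfordPreadjointLinear hf (u n) : Ω → ℝ) ω = u n (f ω) :=
    ae_all_iff.2 fun n => MemLp.coeFn_toLp (hf (u n))
  filter_upwards [hae, hall, MemLp.coeFn_toLp (hf x)] with ω h1 h2 h3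
  have h4 : Tendsto (fun i => u (ns i) (f ω)) atTop (𝓝 (y ω)) :=
    h1.congr fun i => h2 (ns i)
  have h5 : Tendsto (fun i => u (ns i) (f ω)) atTop (𝓝 (x (f ω))) :=
    (((ContinuousLinearMap.apply ℝ ℝ (f ω)).continuous.tendsto x).comp hu).comp
      hns.tendsto_atTop
  exact (tendsto_nhds_unique h4 h5).trans h3.symm

/-- The operator `S_f^p : X* → L^p(μ)`, `x* ↦ ⟨f, x*⟩`. -/
def dunfordPreadjoint {Ω : Type*} [MeasurableSpace Ω] {μ : Measure Ω} {X : Type*}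
    [NormedAddCommGroup X] [NormedSpace ℝ X] {p : ℝ≥0∞} [Fact (1 ≤ p)] {f : Ω → X}
    (hf : IsPDunfordIntegrable p f μ) : StrongDual ℝ X →L[ℝ] Lp ℝ p μ :=
  ⟨dunfordPreadjointLinear hf, dunfordPreadjointLinear_continuous hf⟩

/-- The Dunford operator `T_f^p : L^q(μ) → X**` (`q` the conjugate exponent of `p`): the adjoint
`L^p(μ)* → X**` of `S_f^p`, where `g ∈ L^q(μ)` is regarded as the functional `h ↦ ∫ g h dμ` on
`L^p(μ)`. -/
def dunfordOperator {Ω : Type*} [MeasurableSpace Ω] {μ : Measure Ω} {X : Type*}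
    [NormedAddCommGroup X] [NormedSpace ℝ X] (p q : ℝ≥0∞) [Fact (1 ≤ p)] [Fact (1 ≤ q)]
    [p.HolderConjugate q] {f : Ω → X} (hf : IsPDunfordIntegrable p f μ) :
    Lp ℝ q μ →L[ℝ] StrongDual ℝ (StrongDual ℝ X) :=
  ((dunfordPreadjoint hf).precomp ℝ).comp ((ContinuousLinearMap.mul ℝ ℝ).lpPairing μ q p)

end Integrability

section Kothe

/-- A Köthe function space over `μ`: an order ideal of `L^1(μ)` containing all simple functions,
equipped with a complete lattice norm. -/
structure KotheFunctionSpace {Ω : Type*} [MeasurableSpace Ω] (μ : Measure Ω) where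
  carrier : Submodule ℝ (Lp ℝ 1 μ)
  solid : ∀ f g : Lp ℝ 1 μ, g ∈ carrier → |f| ≤ |g| → f ∈ carrier
  simple_mem : ∀ s : SimpleFunc Ω ℝ, ∃ f ∈ carrier, (f : Ω → ℝ) =ᵐ[μ] s
  norm' : Seminorm ℝ carrier
  eq_zero_of_norm' : ∀ f : carrier, norm' f = 0 → f = 0
  norm'_mono : ∀ f g : carrier, |(f : Lp ℝ 1 μ)| ≤ |(g : Lp ℝ 1 μ)| → norm' f ≤ norm' g
  complete' : ∀ u : ℕ → carrier,
    (∀ ε > 0, ∃ N, ∀ m ≥ N, ∀ n ≥ N, norm' (u m - u n) < ε) →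
      ∃ f : carrier, Tendsto (fun n => norm' (u n - f)) atTop (𝓝 0)

namespace KotheFunctionSpace

/-- The underlying type of a Köthe function space. It is a copy of the ideal, so that it carries
the norm of the Köthe function space and not the `L^1` norm. -/
def Space {Ω : Type*} [MeasurableSpace Ω] {μ : Measure Ω} (Z : KotheFunctionSpace μ) : Type _ :=
  Z.carrier

/-- The element of `L^1(μ)` given by an element of the Köthe function space. -/
def Space.toL1 {Ω : Type*} [MeasurableSpace Ω] {μ : Measure Ω} {Z : KotheFunctionSpace μ}
    (z : Z.Space) : Lp ℝ 1 μ :=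
  Subtype.val (p := fun f => f ∈ Z.carrier) z

instance {Ω : Type*} [MeasurableSpace Ω] {μ : Measure Ω} (Z : KotheFunctionSpace μ) :
    AddCommGroup Z.Space :=
  inferInstanceAs (AddCommGroup Z.carrier)

instance {Ω : Type*} [MeasurableSpace Ω] {μ : Measure Ω} (Z : KotheFunctionSpace μ) :
    Module ℝ Z.Space :=
  inferInstanceAs (Module ℝ Z.carrier)

/-- The order is the one of `L^1(μ)`. -/
instance {Ω : Type*} [MeasurableSpace Ω] {μ : Measure Ω} (Z : KotheFunctionSpace μ) :
    PartialOrder Z.Space :=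
  inferInstanceAs (PartialOrder Z.carrier)

instance {Ω : Type*} [MeasurableSpace Ω] {μ : Measure Ω} (Z : KotheFunctionSpace μ) :
    Norm Z.Space :=
  ⟨fun z => Z.norm' z⟩

theorem core {Ω : Type*} [MeasurableSpace Ω] {μ : Measure Ω} (Z : KotheFunctionSpace μ) :
    NormedSpace.Core ℝ Z.Space where
  norm_nonneg z := apply_nonneg Z.norm' z
  norm_smul c z := map_smul_eq_mul Z.norm' c z
  norm_triangle x y := map_add_le_add Z.norm' x y
  norm_eq_zero_iff z := ⟨Z.eq_zero_of_norm' z, fun h => by subst h; exact map_zero Z.norm'⟩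

instance {Ω : Type*} [MeasurableSpace Ω] {μ : Measure Ω} (Z : KotheFunctionSpace μ) :
    NormedAddCommGroup Z.Space :=
  NormedAddCommGroup.ofCore Z.core

instance {Ω : Type*} [MeasurableSpace Ω] {μ : Measure Ω} (Z : KotheFunctionSpace μ) :
    NormedSpace ℝ Z.Space :=
  NormedSpace.ofCore Z.core

instance {Ω : Type*} [MeasurableSpace Ω] {μ : Measure Ω} (Z : KotheFunctionSpace μ) :
    CompleteSpace Z.Space := by
  refine Metric.complete_of_cauchySeq_tendsto fun u hu => ?_
  rw [Metric.cauchySeq_iff] at hu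
  obtain ⟨f, hf⟩ := Z.complete' u fun ε hε => by
    obtain ⟨N, hN⟩ := hu ε hε
    refine ⟨N, fun m hm n hn => ?_⟩
    have h := hN m hm n hn
    rw [dist_eq_norm] at h
    exact h
  exact ⟨f, tendsto_iff_norm_sub_tendsto_zero.2 hf⟩

/-- `Z` is `q`-convex (`1 ≤ q < ∞`): `‖(∑ |z_i|^q)^{1/q}‖ ≤ C (∑ ‖z_i‖^q)^{1/q}` for a constant
`C > 0`. The function `(∑ |z_i|^q)^{1/q}` always defines an element `w` of the ideal `Z`, since it
is dominated by `∑ |z_i|`. -/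
def IsQConvex {Ω : Type*} [MeasurableSpace Ω] {μ : Measure Ω} (Z : KotheFunctionSpace μ)
    (q : ℝ) : Prop :=
  ∃ C : ℝ, 0 < C ∧ ∀ (n : ℕ) (z : Fin n → Z.Space), ∃ w : Z.Space,
    (w.toL1 : Ω → ℝ) =ᵐ[μ] (fun ω => (∑ i, |(z i).toL1 ω| ^ q) ^ (1 / q)) ∧
      ‖w‖ ≤ C * (∑ i, ‖z i‖ ^ q) ^ (1 / q)

/-- `Z` is order continuous: the norms tend to zero along every downward directed set with infimum
zero (as the norm is monotone on the positive cone, this means that they become arbitrarily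
small). -/
def IsOrderContinuous {Ω : Type*} [MeasurableSpace Ω] {μ : Measure Ω}
    (Z : KotheFunctionSpace μ) : Prop :=
  ∀ D : Set Z.Space, D.Nonempty → DirectedOn (fun x y => y ≤ x) D → IsGLB D 0 →
    ∀ ε > 0, ∃ x ∈ D, ‖x‖ < ε

end KotheFunctionSpace

end Kothe

end

/-! Split `Ω` into countably many sets `B i` of positive measure, and let `e i` be the indicator of
`B i` normalized in `Z`. The supports are disjoint, so `p'`-convexity becomes an upper
`p'`-estimate: `c ↦ ∑ c i • e i` is bounded from `ℓ^{p'}` to `Z`. Take `φ = μ(B i)^{-1/p} • e i` on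
`B i`. Then `‖⟨φ, x'⟩‖_p` is the `ℓ^p` norm of `(x' (e i))`, finite by duality, and the Dunford
operator is `g ↦ ∑ μ(B i)^{-1/p} (∫_{B i} g) • e i`. By Hölder these coefficients lie in `ℓ^{p'}`,
so the series converges in `Z`. Unit multiples of the indicators of the `B i` in `L^{p'}` are sent
to the `e i`, which are 1-separated because the norm is a lattice norm; hence the operator is not
compact.

The Banach space argument is `exists_isPPettisIntegrable_not_isCompactOperator`;
`norm_sum_smul_le_of_isQConvex` and `one_le_norm_sub_of_ae_eq_ite` supply its hypotheses in `Z`. -/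

/-! ### Sequences with an upper `q`-estimate -/

/-- If `(e i)` satisfies an upper `q`-estimate, then it is weakly `p`-summable. -/
theorem summable_rpow_abs_apply_of_upper_estimate {X : Type*} [NormedAddCommGroup X]
    [NormedSpace ℝ X] {r q : ℝ} (hrq : r.HolderConjugate q) {e : ℕ → X} {C : ℝ} (hC : 0 ≤ C)
    (hup : ∀ (s : Finset ℕ) (c : ℕ → ℝ),
      ‖∑ i ∈ s, c i • e i‖ ≤ C * (∑ i ∈ s, |c i| ^ q) ^ (1 / q))
    (x' : StrongDual ℝ X) : Summable fun i => |x' (e i)| ^ r := by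
  refine summable_of_sum_le (c := (‖x'‖ * C) ^ r) (fun i => by positivity) fun s => ?_
  set f : ℕ → NNReal := fun i => ‖x' (e i)‖₊ with hf
  -- `g` lies in the `ℓ^q` unit ball and attains the `ℓ^r` norm of `f` on `s`; the signs put into
  -- `c` below remove the absolute values.
  obtain ⟨⟨g, hg, hgs⟩, -⟩ := NNReal.isGreatest_Lp s f hrq
  have hg' : ∑ i ∈ s, ((g i : ℝ)) ^ q ≤ 1 := by exact_mod_cast hg
  have hgs' : ∑ i ∈ s, |x' (e i)| * (g i : ℝ) = (∑ i ∈ s, |x' (e i)| ^ r) ^ (1 / r) := by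
    have := congrArg ((↑) : NNReal → ℝ) hgs
    simpa [hf, NNReal.coe_rpow] using this
  have h0 : 0 ≤ ∑ i ∈ s, |x' (e i)| ^ r := Finset.sum_nonneg fun i _ => by positivity
  have key : (∑ i ∈ s, |x' (e i)| ^ r) ^ (1 / r) ≤ ‖x'‖ * C := by
    set c : ℕ → ℝ := fun i => SignType.sign (x' (e i)) * g i
    have h1 : x' (∑ i ∈ s, c i • e i) = ∑ i ∈ s, |x' (e i)| * (g i : ℝ) := by
      rw [map_sum]
      refine Finset.sum_congr rfl fun i _ => ?_
      rw [map_smul, smul_eq_mul, ← sign_mul_self (x' (e i))]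
      simp only [c]; ring
    have h2 : ∑ i ∈ s, |c i| ^ q ≤ ∑ i ∈ s, (g i : ℝ) ^ q := by
      refine Finset.sum_le_sum fun i _ => ?_
      refine Real.rpow_le_rpow (abs_nonneg _) ?_ hrq.symm.nonneg
      rw [abs_mul, NNReal.abs_eq]
      refine mul_le_of_le_one_left (g i).2 ?_
      rcases lt_trichotomy (x' (e i)) 0 with h | h | h <;> simp [h]
    have h3 : (∑ i ∈ s, |c i| ^ q) ^ (1 / q) ≤ 1 :=
      Real.rpow_le_one (Finset.sum_nonneg fun i _ => by positivity) (h2.trans hg')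
        (one_div_nonneg.2 hrq.symm.nonneg)
    rw [← hgs', ← h1]
    calc x' (∑ i ∈ s, c i • e i) ≤ ‖x' (∑ i ∈ s, c i • e i)‖ := Real.le_norm_self _
      _ ≤ ‖x'‖ * ‖∑ i ∈ s, c i • e i‖ := x'.le_opNorm _
      _ ≤ ‖x'‖ * (C * 1) := by gcongr; exact (hup s c).trans (by gcongr)
      _ = ‖x'‖ * C := by ring
  calc ∑ i ∈ s, |x' (e i)| ^ r = ((∑ i ∈ s, |x' (e i)| ^ r) ^ (1 / r)) ^ r := by
        rw [← Real.rpow_mul h0, one_div_mul_cancel hrq.ne_zero, Real.rpow_one]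
    _ ≤ (‖x'‖ * C) ^ r := Real.rpow_le_rpow (by positivity) key hrq.nonneg

/-- If `(e i)` satisfies an upper `q`-estimate, then `∑ c i • e i` converges for `c ∈ ℓ^q`. -/
theorem summable_smul_of_upper_estimate {X : Type*} [NormedAddCommGroup X]
    [NormedSpace ℝ X] [CompleteSpace X] {q : ℝ} (hq : 0 < q) {e : ℕ → X} {C : ℝ} (hC : 0 ≤ C)
    (hup : ∀ (s : Finset ℕ) (c : ℕ → ℝ),
      ‖∑ i ∈ s, c i • e i‖ ≤ C * (∑ i ∈ s, |c i| ^ q) ^ (1 / q))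
    {c : ℕ → ℝ} (hc : Summable fun i => |c i| ^ q) : Summable fun i => c i • e i := by
  rw [summable_iff_vanishing_norm] at hc ⊢
  intro ε hε
  -- `C + 1` instead of `C`, since `C` may be zero.
  obtain ⟨s, hs⟩ := hc ((ε / (C + 1)) ^ q) (by positivity)
  refine ⟨s, fun t ht => (hup t c).trans_lt ?_⟩
  have h0 : 0 ≤ ∑ i ∈ t, |c i| ^ q := Finset.sum_nonneg fun i _ => by positivity
  have h1 : (∑ i ∈ t, |c i| ^ q) ^ (1 / q) < ε / (C + 1) := by
    rw [one_div, Real.rpow_inv_lt_iff_of_pos h0 (by positivity) hq]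
    exact (Real.le_norm_self _).trans_lt (hs t ht)
  calc C * (∑ i ∈ t, |c i| ^ q) ^ (1 / q) ≤ (C + 1) * (∑ i ∈ t, |c i| ^ q) ^ (1 / q) := by
        gcongr; linarith
    _ < (C + 1) * (ε / (C + 1)) := by gcongr
    _ = ε := by field_simp

/-! ### Integration over the fibers of a measurable map to `ℕ` -/

section Fibers

variable {Ω : Type*} [MeasurableSpace Ω] {μ : Measure Ω}

theorem hasSum_setIntegral_fiber {k : Ω → ℕ} (hk : Measurable k) {f : Ω → ℝ}
    (hf : Integrable f μ) : HasSum (fun i => ∫ ω in k ⁻¹' {i}, f ω ∂μ) (∫ ω, f ω ∂μ) := by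
  have hU : ⋃ i, k ⁻¹' {i} = Set.univ := by ext; simp
  have := hasSum_integral_iUnion (μ := μ) (f := f) (s := fun i => k ⁻¹' {i})
    (fun i => hk (measurableSet_singleton i))
    (fun i j hij => Disjoint.preimage k (by simpa using hij)) hf.integrableOn
  rwa [hU, setIntegral_univ] at this

theorem memLp_comp_of_summable [IsFiniteMeasure μ] {k : Ω → ℕ} (hk : Measurable k) {p : ℝ≥0∞}
    (hp : p ≠ 0) (hp_top : p ≠ ∞) {w : ℕ → ℝ}
    (hw : Summable fun i => μ.real (k ⁻¹' {i}) * |w i| ^ p.toReal) :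
    MemLp (fun ω => w (k ω)) p μ := by
  have hm : Measurable fun ω => w (k ω) := (measurable_from_top (f := w)).comp hk
  rw [← integrable_norm_rpow_iff hm.aestronglyMeasurable hp hp_top]
  have hU : ⋃ i, k ⁻¹' {i} = Set.univ := by ext; simp
  have hc : ∀ i, Set.EqOn (fun ω => ‖w (k ω)‖ ^ p.toReal) (fun _ => |w i| ^ p.toReal)
      (k ⁻¹' {i}) := by
    rintro i ω rfl; rfl
  have hms : ∀ i, MeasurableSet (k ⁻¹' {i}) := fun i => hk (measurableSet_singleton i)
  rw [← integrableOn_univ, ← hU]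
  refine integrableOn_iUnion_of_summable_integral_norm (fun i => ?_) (hw.congr fun i => ?_)
  · exact (integrableOn_congr_fun (hc i) (hms i)).2 (integrable_const _)
  · rw [setIntegral_congr_fun (g := fun _ => |w i| ^ p.toReal) (hms i), setIntegral_const,
      smul_eq_mul]
    intro ω hω
    have := hc i hω
    simp only at this ⊢
    rw [this, Real.norm_of_nonneg (by positivity)]

/-- Hölder's inequality on a set of positive finite measure. -/
theorem rpow_abs_setIntegral_le [IsFiniteMeasure μ] {r q : ℝ} (hrq : r.HolderConjugate q)
    {B : Set Ω} (hB : 0 < μ.real B) {g : Ω → ℝ} (hg : MemLp g (ENNReal.ofReal q) μ) :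
    |μ.real B ^ (-(1 / r)) * ∫ ω in B, g ω ∂μ| ^ q ≤ ∫ ω in B, |g ω| ^ q ∂μ := by
  have hg' : MemLp g (ENNReal.ofReal q) (μ.restrict B) := hg.restrict B
  have h := integral_mul_le_Lp_mul_Lq_of_nonneg (μ := μ.restrict B) hrq (f := fun _ => 1)
    (g := fun ω => |g ω|) (Eventually.of_forall fun _ => zero_le_one)
    (Eventually.of_forall fun _ => abs_nonneg _) (memLp_const _) hg'.abs
  simp only [one_mul, Real.one_rpow, integral_const, smul_eq_mul, mul_one,
    measureReal_restrict_apply_univ] at h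
  have h0 : 0 ≤ ∫ ω in B, |g ω| ^ q ∂μ := integral_nonneg fun _ => by positivity
  -- The weight cancels the factor `μ(B)^{1/r}` that Hölder produces for the constant function 1.
  have h1 : |μ.real B ^ (-(1 / r)) * ∫ ω in B, g ω ∂μ| ≤ (∫ ω in B, |g ω| ^ q ∂μ) ^ (1 / q) := by
    rw [abs_mul, abs_of_nonneg (by positivity), Real.rpow_neg hB.le, inv_mul_le_iff₀ (by positivity)]
    exact (abs_integral_le_integral_abs).trans h
  calc _ ≤ ((∫ ω in B, |g ω| ^ q ∂μ) ^ (1 / q)) ^ q :=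
        Real.rpow_le_rpow (abs_nonneg _) h1 hrq.symm.nonneg
    _ = _ := by rw [← Real.rpow_mul h0, one_div_mul_cancel hrq.symm.ne_zero, Real.rpow_one]

end Fibers

/-! ### The Dunford operator and the construction in a Banach space -/

theorem dunfordOperator_apply_apply {Ω : Type*} [MeasurableSpace Ω] {μ : Measure Ω} {X : Type*}
    [NormedAddCommGroup X] [NormedSpace ℝ X] (p q : ℝ≥0∞) [Fact (1 ≤ p)] [Fact (1 ≤ q)]
    [p.HolderConjugate q] {f : Ω → X} (hf : IsPDunfordIntegrable p f μ) (g : Lp ℝ q μ)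
    (x' : StrongDual ℝ X) : dunfordOperator p q hf g x' = ∫ ω, g ω * x' (f ω) ∂μ := by
  have h : dunfordOperator p q hf g x' =
      (ContinuousLinearMap.mul ℝ ℝ).lpPairing μ q p g (dunfordPreadjoint hf x') := rfl
  rw [h, ContinuousLinearMap.lpPairing_eq_integral]
  refine integral_congr_ae ?_
  filter_upwards [MemLp.coeFn_toLp (hf x')] with ω hω
  exact congrArg (g ω * ·) hω

/-- An operator all of whose values lie in the range of an isometric embedding factors through
it. -/
theorem exists_lift_of_forall_exists_linearIsometry {E F X : Type*} [NormedAddCommGroup E]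
    [NormedSpace ℝ E] [NormedAddCommGroup F] [NormedSpace ℝ F] [NormedAddCommGroup X]
    [NormedSpace ℝ X] (J : X →ₗᵢ[ℝ] F) (S : E →L[ℝ] F) (hS : ∀ g, ∃ z : X, J z = S g) :
    ∃ T : E →L[ℝ] X, ∀ g, J (T g) = S g := by
  choose T hT using hS
  refine ⟨LinearMap.mkContinuous ⟨⟨T, fun x y => J.injective ?_⟩, fun c x => J.injective ?_⟩
    ‖S‖ fun g => ?_, hT⟩
  · simp [hT]
  · simp [hT]
  · refine le_of_eq_of_le ?_ (S.le_opNorm g)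
    rw [← hT]
    exact (J.norm_map (T g)).symm

/-- An operator sending a sequence of the unit ball to a uniformly separated one is not compact. -/
theorem not_isCompactOperator_of_separated {E X : Type*} [NormedAddCommGroup E]
    [NormedSpace ℝ E] [NormedAddCommGroup X] [NormedSpace ℝ X] (T : E →L[ℝ] X) (g : ℕ → E)
    (hg : ∀ i, ‖g i‖ ≤ 1) (hsep : ∀ i j, i ≠ j → 1 ≤ ‖T (g i) - T (g j)‖) :
    ¬ IsCompactOperator T := by
  intro hT
  obtain ⟨K, hK, hsub⟩ := IsCompactOperator.image_closedBall_subset_compact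
    (f := (T : E →ₗ[ℝ] X)) hT 1
  obtain ⟨x, -, ψ, hψ, hlim⟩ := hK.tendsto_subseq (x := fun i => T (g i)) fun i =>
    hsub ⟨g i, by simpa using hg i, rfl⟩
  obtain ⟨N, hN⟩ := Metric.cauchySeq_iff.1 hlim.cauchySeq 1 one_pos
  have h := hN N le_rfl (N + 1) (Nat.le_succ N)
  rw [dist_eq_norm] at h
  exact absurd (hsep _ _ (hψ.injective.ne (Nat.succ_ne_self N).symm)) (not_le.2 h)

/-- The lattice structure enters only through `hup` and `hsep`, so the construction works in any
Banach space with such a sequence. -/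
theorem exists_isPPettisIntegrable_not_isCompactOperator {Ω : Type*} [MeasurableSpace Ω]
    {μ : Measure Ω} [IsProbabilityMeasure μ] {X : Type*} [NormedAddCommGroup X] [NormedSpace ℝ X]
    [CompleteSpace X] (p p' : ℝ≥0∞) (hp : 1 < p) (hp_top : p < ∞)
    [Fact (1 ≤ p)] [Fact (1 ≤ p')] [p.HolderConjugate p'] {k : Ω → ℕ} (hk : Measurable k)
    (hpos : ∀ i, 0 < μ (k ⁻¹' {i})) {e : ℕ → X} {C : ℝ} (hC : 0 ≤ C)
    (hup : ∀ (s : Finset ℕ) (c : ℕ → ℝ),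
      ‖∑ i ∈ s, c i • e i‖ ≤ C * (∑ i ∈ s, |c i| ^ p'.toReal) ^ (1 / p'.toReal))
    (hsep : ∀ i j, i ≠ j → 1 ≤ ‖e i - e j‖) :
    ∃ φ : Ω → X, AEStronglyMeasurable φ μ ∧
      ∃ hφ : IsPPettisIntegrable p φ μ,
        ∃ T : Lp ℝ p' μ →L[ℝ] X,
          (∀ g : Lp ℝ p' μ,
            NormedSpace.inclusionInDoubleDual ℝ X (T g) = dunfordOperator p p' hφ.1 g) ∧
          ¬ IsCompactOperator T := by
  have hr : 1 < p.toReal := by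
    simpa using (ENNReal.toReal_lt_toReal ENNReal.one_ne_top hp_top.ne).2 hp
  have hrq : p.toReal.HolderConjugate p'.toReal := ENNReal.HolderConjugate.toReal hr
  have hp'_top : p' ≠ ∞ := by
    intro h; have := hrq.symm.pos; simp [h] at this
  have hp'0 : p' ≠ 0 := by
    intro h; have := hrq.symm.pos; simp [h] at this
  have hms : ∀ i, MeasurableSet (k ⁻¹' {i}) := fun i => hk (measurableSet_singleton i)
  set m : ℕ → ℝ := fun i => μ.real (k ⁻¹' {i}) with hm
  have hm0 : ∀ i, 0 < m i := fun i => ENNReal.toReal_pos (hpos i).ne' (measure_ne_top _ _)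
  -- The exponent makes the factor `m i` cancel in `∫ |x' ∘ φ|^p = ∑ m i * |x' (v i)|^p`.
  set v : ℕ → X := fun i => m i ^ (-(1 / p.toReal)) • e i with hv
  set φ : Ω → X := fun ω => v (k ω) with hφdef
  have hD : IsPDunfordIntegrable p φ μ := by
    intro x'
    refine memLp_comp_of_summable (w := fun i => x' (v i)) hk (zero_lt_one.trans hp).ne'
      hp_top.ne ((summable_rpow_abs_apply_of_upper_estimate hrq hC hup x').congr fun i => ?_)
    have : (m i ^ (-(1 / p.toReal))) ^ p.toReal = (m i)⁻¹ := by
      rw [← Real.rpow_mul (hm0 i).le, neg_mul, one_div_mul_cancel hrq.ne_zero, Real.rpow_neg_one]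
    rw [hv, map_smul, smul_eq_mul, abs_mul, Real.mul_rpow (abs_nonneg _) (abs_nonneg _),
      abs_of_nonneg (Real.rpow_nonneg (hm0 i).le _), this, ← mul_assoc]
    change _ = m i * (m i)⁻¹ * _
    rw [mul_inv_cancel₀ (hm0 i).ne', one_mul]
  have hint : ∀ (g : Lp ℝ p' μ) (x' : StrongDual ℝ X), Integrable (fun ω => g ω * x' (φ ω)) μ :=
    fun g x' => MemLp.integrable_mul (p := p') (q := p) (Lp.memLp g) (hD x')
  have hS : ∀ g : Lp ℝ p' μ, ∃ z : X,
      NormedSpace.inclusionInDoubleDual ℝ X z = dunfordOperator p p' hD g := by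
    intro g
    have hg : MemLp g (ENNReal.ofReal p'.toReal) μ := by
      rw [ENNReal.ofReal_toReal hp'_top]; exact Lp.memLp g
    -- The coefficients of `g` are dominated, after raising to the power `p'`, by the integrals of
    -- `|g|^p'` over the fibers.
    have hsum : Summable fun i =>
        |m i ^ (-(1 / p.toReal)) * ∫ ω in k ⁻¹' {i}, g ω ∂μ| ^ p'.toReal := by
      refine Summable.of_nonneg_of_le (fun i => by positivity)
        (fun i => rpow_abs_setIntegral_le hrq (hm0 i) hg)
        (hasSum_setIntegral_fiber hk (f := fun ω => |g ω| ^ p'.toReal) ?_).summable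
      exact (Lp.memLp g).integrable_norm_rpow hp'0 hp'_top
    obtain ⟨z, hz⟩ := summable_smul_of_upper_estimate hrq.symm.pos hC hup hsum
    refine ⟨z, ContinuousLinearMap.ext fun x' => ?_⟩
    rw [NormedSpace.dual_def, dunfordOperator_apply_apply]
    refine (x'.hasSum hz).unique ((hasSum_setIntegral_fiber hk (hint g x')).congr_fun fun i => ?_)
    have h : ∫ ω in k ⁻¹' {i}, g ω * x' (φ ω) ∂μ = ∫ ω in k ⁻¹' {i}, g ω * x' (v i) ∂μ := by
      refine setIntegral_congr_fun (hms i) ?_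
      rintro ω rfl
      rfl
    rw [h, integral_mul_const]
    simp only [hv, map_smul, smul_eq_mul]
    ring
  have hP : IsPPettisIntegrable p φ μ := by
    refine ⟨hD, fun x' => (hD x').mono_exponent hp.le, fun A hA => ?_⟩
    -- The Pettis integral over `A` is the value of the Dunford operator at the indicator of `A`.
    obtain ⟨z, hz⟩ := hS (indicatorConstLp p' hA (measure_ne_top μ A) (1 : ℝ))
    refine ⟨z, fun x' => ?_⟩
    rw [← NormedSpace.dual_def ℝ X, hz, dunfordOperator_apply_apply, ← integral_indicator hA]
    refine integral_congr_ae ?_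
    filter_upwards [indicatorConstLp_coeFn (p := p') (hs := hA) (hμs := measure_ne_top μ A)
      (c := (1 : ℝ))] with ω hω
    rw [hω]
    by_cases h : ω ∈ A <;> simp [h]
  obtain ⟨T, hT⟩ := exists_lift_of_forall_exists_linearIsometry
    (E := Lp ℝ p' μ) (F := StrongDual ℝ (StrongDual ℝ X)) (X := X) (NormedSpace.inclusionInDoubleDualLi (E := X) ℝ) (dunfordOperator p p' hD)
    (fun g => hS g)
  refine ⟨φ, ?_, hP, T, hT, ?_⟩
  · exact ((StronglyMeasurable.of_discrete (f := v)).comp_measurable hk).aestronglyMeasurable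
  -- Indicators of the fibers, normalized in `L^{p'}`.
  set g : ℕ → Lp ℝ p' μ := fun i =>
    indicatorConstLp p' (hms i) (measure_ne_top μ _) (m i ^ (-(1 / p'.toReal))) with hg
  have hTg : ∀ i, T (g i) = e i := by
    intro i
    refine (NormedSpace.inclusionInDoubleDualLi (E := X) ℝ).injective ?_
    refine (hT (g i)).trans (ContinuousLinearMap.ext fun x' => ?_)
    change _ = x' (e i)
    rw [dunfordOperator_apply_apply]
    have h1 : ∫ ω, g i ω * x' (φ ω) ∂μ =
        ∫ ω in k ⁻¹' {i}, m i ^ (-(1 / p'.toReal)) * x' (v i) ∂μ := by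
      rw [← integral_indicator (hms i)]
      refine integral_congr_ae ?_
      filter_upwards [indicatorConstLp_coeFn (p := p') (hs := hms i)
        (hμs := measure_ne_top μ _) (c := m i ^ (-(1 / p'.toReal)))] with ω hω
      rw [hg, hω]
      by_cases h : k ω = i
      · simp [h, hφdef]
      · simp [h]
    rw [h1, setIntegral_const, hv, map_smul, smul_eq_mul, smul_eq_mul]
    change m i * _ = _
    have h2 : m i * (m i ^ (-(1 / p'.toReal)) * m i ^ (-(1 / p.toReal))) = 1 := by
      rw [← Real.rpow_add (hm0 i)]
      have : -(1 / p'.toReal) + -(1 / p.toReal) = -1 := by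
        have := hrq.inv_add_inv_eq_one
        rw [one_div, one_div]; linarith
      rw [this, Real.rpow_neg_one, mul_inv_cancel₀ (hm0 i).ne']
    rw [← mul_assoc, ← mul_assoc, mul_assoc (m i), h2, one_mul]
  refine not_isCompactOperator_of_separated T g (fun i => ?_) fun i j hij => ?_
  · rw [hg, norm_indicatorConstLp hp'0 hp'_top, Real.norm_of_nonneg (Real.rpow_nonneg (hm0 i).le _)]
    change _ * m i ^ _ ≤ _
    rw [← Real.rpow_add (hm0 i)]
    simp
  · rw [hTg, hTg]; exact hsep i j hij

/-- Each fiber of `k` contains the corresponding `A i`. Points outside the union satisfy the search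
condition at once and are sent to `0`, so the fibers cover `Ω`. -/
theorem exists_measurable_nat_fiber_pos {Ω : Type*} [MeasurableSpace Ω] {μ : Measure Ω}
    {A : ℕ → Set Ω} (hA : ∀ i, MeasurableSet (A i)) (hd : ∀ i j, i ≠ j → Disjoint (A i) (A j))
    (hpos : ∀ i, 0 < μ (A i)) : ∃ k : Ω → ℕ, Measurable k ∧ ∀ i, 0 < μ (k ⁻¹' {i}) := by
  classical
  have hex : ∀ ω, ∃ n, ω ∈ A n ∨ ω ∉ ⋃ i, A i := by
    intro ω
    by_cases h : ω ∈ ⋃ i, A i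
    · obtain ⟨n, hn⟩ := Set.mem_iUnion.1 h
      exact ⟨n, Or.inl hn⟩
    · exact ⟨0, Or.inr h⟩
  refine ⟨fun ω => Nat.find (hex ω), measurable_find hex fun n =>
    (hA n).union (MeasurableSet.iUnion hA).compl, fun i => (hpos i).trans_le (measure_mono ?_)⟩
  intro ω hω
  have hU : ω ∈ ⋃ i, A i := Set.mem_iUnion.2 ⟨i, hω⟩
  have h := (Nat.find_spec (hex ω)).resolve_right (not_not_intro hU)
  by_contra hne
  exact Set.disjoint_left.1 (hd _ _ hne) h hω

/-! ### Normalized indicators in a Köthe function space -/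

namespace KotheFunctionSpace

variable {Ω : Type*} [MeasurableSpace Ω] {μ : Measure Ω} {Z : KotheFunctionSpace μ}

theorem norm_le_norm_of_ae_abs_le {f g : Z.Space}
    (h : ∀ᵐ ω ∂μ, |f.toL1 ω| ≤ |g.toL1 ω|) : ‖f‖ ≤ ‖g‖ := by
  refine Z.norm'_mono f g ?_
  rw [← Lp.coeFn_le]
  filter_upwards [h, Lp.coeFn_abs f.toL1, Lp.coeFn_abs g.toL1] with ω h1 h2 h3
  exact (h2.trans_le h1).trans_eq h3.symm

theorem Space.toL1_sum_smul (s : Finset ℕ) (c : ℕ → ℝ) (e : ℕ → Z.Space) :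
    ∀ᵐ ω ∂μ, (∑ i ∈ s, c i • e i).toL1 ω = ∑ i ∈ s, c i * (e i).toL1 ω := by
  have h : (∑ i ∈ s, c i • e i).toL1 = ∑ i ∈ s, c i • (e i).toL1 :=
    map_sum Z.carrier.subtype (fun i => c i • (show Z.carrier from e i)) s
  rw [h]
  have h2 : ∀ᵐ ω ∂μ, ∀ i, (c i • (e i).toL1) ω = c i * (e i).toL1 ω :=
    ae_all_iff.2 fun i => Lp.coeFn_smul (c i) (e i).toL1
  filter_upwards [h2, Lp.coeFn_finsetSum s (fun i => c i • (e i).toL1)] with ω h3 h4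
  rw [h4, Finset.sum_apply]
  exact Finset.sum_congr rfl fun i _ => h3 i

/-- A `q`-convex Köthe function space contains normalized multiples of the indicators of the
fibers of `k`. -/
theorem exists_norm_eq_one_ae_eq_ite {k : Ω → ℕ} (hk : Measurable k)
    (hpos : ∀ i, 0 < μ (k ⁻¹' {i})) (i : ℕ) :
    ∃ (e : Z.Space) (a : ℝ), ‖e‖ = 1 ∧ ∀ᵐ ω ∂μ, e.toL1 ω = if k ω = i then a else 0 := by
  obtain ⟨f, hf, hfi⟩ := Z.simple_mem
    ((SimpleFunc.const Ω (1 : ℝ)).restrict (k ⁻¹' {i}))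
  rw [SimpleFunc.coe_restrict _ (hk (measurableSet_singleton i))] at hfi
  set u : Z.Space := ⟨f, hf⟩ with hu
  have hu0 : u ≠ 0 := by
    intro h
    have hf0 : f = 0 := congrArg Space.toL1 h
    have : ∀ᵐ ω ∂μ, ω ∉ k ⁻¹' {i} := by
      filter_upwards [hfi, Lp.coeFn_zero ℝ 1 μ] with ω h1 h2 h3
      rw [hf0, h2, Set.indicator_of_mem h3] at h1
      simp at h1
    exact (hpos i).ne' (measure_eq_zero_iff_ae_notMem.2 this)
  refine ⟨‖u‖⁻¹ • u, ‖u‖⁻¹, ?_, ?_⟩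
  · rw [norm_smul, norm_inv, norm_norm, inv_mul_cancel₀ (norm_ne_zero_iff.2 hu0)]
  have h1 : ∀ᵐ ω ∂μ, (‖u‖⁻¹ • u).toL1 ω = ‖u‖⁻¹ * f ω := Lp.coeFn_smul ‖u‖⁻¹ f
  filter_upwards [h1, hfi] with ω h2 h3
  rw [h2, h3]
  by_cases h : k ω = i <;> simp [h]

/-- Disjointness of supports gives `|e i| ≤ |e i - e j|` almost everywhere. -/
theorem one_le_norm_sub_of_ae_eq_ite {k : Ω → ℕ} {e : ℕ → Z.Space} {a : ℕ → ℝ}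
    (he : ∀ i, ‖e i‖ = 1) (hea : ∀ i, ∀ᵐ ω ∂μ, (e i).toL1 ω = if k ω = i then a i else 0)
    {i j : ℕ} (hij : i ≠ j) : 1 ≤ ‖e i - e j‖ := by
  rw [← he i]
  refine norm_le_norm_of_ae_abs_le ?_
  have h : ∀ᵐ ω ∂μ, (e i - e j).toL1 ω = (e i).toL1 ω - (e j).toL1 ω :=
    Lp.coeFn_sub (e i).toL1 (e j).toL1
  filter_upwards [h, hea i, hea j] with ω h1 h2 h3
  rw [h1, h2, h3]
  by_cases hi : k ω = i
  · simp [hi, hij]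
  · simp [hi]

/-- At almost every point at most one term is nonzero, so the `q`-th power mean in the convexity
inequality coincides with `|∑ c i • e i|`. -/
theorem norm_sum_smul_le_of_isQConvex {q C : ℝ} (hq : 0 < q)
    (hconv : ∀ (n : ℕ) (z : Fin n → Z.Space), ∃ w : Z.Space,
      (w.toL1 : Ω → ℝ) =ᵐ[μ] (fun ω => (∑ i, |(z i).toL1 ω| ^ q) ^ (1 / q)) ∧
        ‖w‖ ≤ C * (∑ i, ‖z i‖ ^ q) ^ (1 / q))
    {k : Ω → ℕ} {e : ℕ → Z.Space} {a : ℕ → ℝ} (he : ∀ i, ‖e i‖ = 1)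
    (hea : ∀ i, ∀ᵐ ω ∂μ, (e i).toL1 ω = if k ω = i then a i else 0)
    (s : Finset ℕ) (c : ℕ → ℝ) :
    ‖∑ i ∈ s, c i • e i‖ ≤ C * (∑ i ∈ s, |c i| ^ q) ^ (1 / q) := by
  -- Convexity is stated for families over `Fin n`; this carries sums over `s` to that index set.
  have hsum : ∀ F : ℕ → ℝ, ∑ j, F (s.equivFin.symm j) = ∑ i ∈ s, F i := fun F => by
    rw [← Finset.sum_coe_sort s]
    exact s.equivFin.symm.sum_comp fun i : s => F i
  obtain ⟨w, hw, hwC⟩ := hconv s.card fun j => c (s.equivFin.symm j) • e (s.equivFin.symm j)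
  rw [hsum fun i => ‖c i • e i‖ ^ q] at hwC
  simp only [norm_smul, he, mul_one, Real.norm_eq_abs] at hwC
  refine le_trans (norm_le_norm_of_ae_abs_le ?_) hwC
  have hsm : ∀ᵐ ω ∂μ, ∀ i, (c i • e i).toL1 ω = c i * (e i).toL1 ω :=
    ae_all_iff.2 fun i => Lp.coeFn_smul (c i) (e i).toL1
  filter_upwards [hw, hsm, ae_all_iff.2 hea, Space.toL1_sum_smul s c e] with ω h1 h2 h3 h4
  rw [h1, h4, hsum fun i => |(c i • e i).toL1 ω| ^ q]
  have h5 : ∀ i, |(c i • e i).toL1 ω| ^ q = if k ω = i then |c i * a i| ^ q else 0 := by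
    intro i
    rw [h2, h3]
    split_ifs <;> simp [hq.ne']
  simp only [h5, h3, mul_ite, mul_zero, Finset.sum_ite_eq]
  split_ifs
  · rw [← Real.rpow_mul (abs_nonneg _), mul_one_div_cancel hq.ne', Real.rpow_one, abs_abs]
  · simp

end KotheFunctionSpace

theorem mainTheorem12 {Ω : Type*} [MeasurableSpace Ω] (μ : Measure Ω) [IsProbabilityMeasure μ]
    [μ.IsComplete]
    (hμ : ∃ A : ℕ → Set Ω, (∀ i, MeasurableSet (A i)) ∧
      (∀ i j, i ≠ j → Disjoint (A i) (A j)) ∧ ∀ i, 0 < μ (A i))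
    (p p' : ℝ≥0∞) (hp : 1 < p) (hp_top : p < ∞)
    [Fact (1 ≤ p)] [Fact (1 ≤ p')] [p.HolderConjugate p']
    (Z : KotheFunctionSpace μ) (hconv : Z.IsQConvex p'.toReal) (hoc : Z.IsOrderContinuous) :
    ∃ φ : Ω → Z.Space, AEStronglyMeasurable φ μ ∧
      ∃ hφ : IsPPettisIntegrable p φ μ,
        ∃ T : Lp ℝ p' μ →L[ℝ] Z.Space,
          (∀ g : Lp ℝ p' μ,
            NormedSpace.inclusionInDoubleDual ℝ Z.Space (T g) = dunfordOperator p p' hφ.1 g) ∧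
          ¬ IsCompactOperator T := by
  obtain ⟨A, hA, hd, hApos⟩ := hμ
  obtain ⟨k, hk, hpos⟩ := exists_measurable_nat_fiber_pos hA hd hApos
  obtain ⟨C, hC, hCz⟩ := hconv
  choose e a he hea using KotheFunctionSpace.exists_norm_eq_one_ae_eq_ite (Z := Z) hk hpos
  have hr : 1 < p.toReal := by
    simpa using (ENNReal.toReal_lt_toReal ENNReal.one_ne_top hp_top.ne).2 hp
  have hrq : p.toReal.HolderConjugate p'.toReal := ENNReal.HolderConjugate.toReal hr
  exact exists_isPPettisIntegrable_not_isCompactOperator p p' hp hp_top hk hpos hC.le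
    (KotheFunctionSpace.norm_sum_smul_le_of_isQConvex hrq.symm.pos hCz he hea)
    fun i j hij => KotheFunctionSpace.one_le_norm_sub_of_ae_eq_ite he hea hij
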